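/- \textbf{Proposition (Helly).} A \emph{Hadamard space} is a nonempty complete CAT(0) metric space (not necessarily locally compact or a manifold); it is \emph{$n$-dimensional} if its Lebesgue covering dimension is $n$. A geodesic metric space is \emph{$\delta$-hyperbolic} if each side of every geodesic triangle is contained in the closed $\delta$-neighbourhood of the union of the other two sides. A subset is \emph{convex} if it contains the geodesic segment between any two of its points. Let $n\ge 0$ be an integer and let $X$ be a $\delta$-hyperbolic $n$-dimensional Hadamard space with metric $d$. Suppose that $B_1,\dots,B_k$ are convex subsets of $X$, not assumed to be closed, such that $B_i\cap B_j\neq\emptyset$ for all $i,j\in\{1,\dots,k\}$ (including $i=j$, so that each $B_i$ is nonempty). Then there is a point $x\in X$ such that $d(x,B_i)\le n\delta$ for all $i=1,\dots,k$, where $d(x,B_i)=\inf_{b\in B_i}d(x,b)$. -/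

import Mathlib

/-!
Geodesics, Hadamard spaces (complete CAT(0) spaces), hyperbolicity in the sense of slim triangles,
geodesic convexity, and Lebesgue covering dimension.
-/

section MetricNotions

variable {X : Type*} [MetricSpace X]

/-- `γ` restricted to `[0, d(x, y)]` is a geodesic, parametrized by arc length, from `x` to `y`. -/
structure IsGeodesicFrom (γ : ℝ → X) (x y : X) : Prop where
  source : γ 0 = x
  target : γ (dist x y) = y
  isometric : ∀ s ∈ Set.Icc 0 (dist x y), ∀ t ∈ Set.Icc 0 (dist x y), dist (γ s) (γ t) = |s - t|

/-- `S` is a geodesic segment with endpoints `x` and `y`, i.e. the image of a geodesic. -/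
def IsGeodesicSegment (x y : X) (S : Set X) : Prop :=
  ∃ γ : ℝ → X, IsGeodesicFrom γ x y ∧ S = γ '' Set.Icc 0 (dist x y)

/-- A set is convex if it contains every geodesic segment joining two of its points. -/
def IsGeodesicallyConvex (A : Set X) : Prop :=
  ∀ x ∈ A, ∀ y ∈ A, ∀ S : Set X, IsGeodesicSegment x y S → S ⊆ A

variable (X)

/-- Every two points are joined by a geodesic segment. -/
def IsGeodesicSpace : Prop :=
  ∀ x y : X, ∃ S : Set X, IsGeodesicSegment x y S

/-- The CAT(0) inequality: for each geodesic triangle with vertices `p`, `q`, `r`, points `x`, `y`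
on the sides `pq`, `pr`, and a comparison triangle `p'`, `q'`, `r'` in the Euclidean plane with
comparison points `x'`, `y'`, the distance of `x` and `y` is at most that of `x'` and `y'`.
(Two points on the same side are at the same distance as their comparison points, and the other
pairs of sides are covered by permuting the vertices.) -/
def SatisfiesCAT0 : Prop :=
  ∀ (p q r : X) (S T : Set X), IsGeodesicSegment p q S → IsGeodesicSegment p r T →
  ∀ x ∈ S, ∀ y ∈ T, ∀ p' q' r' x' y' : EuclideanSpace ℝ (Fin 2),
    dist p' q' = dist p q → dist q' r' = dist q r → dist p' r' = dist p r →
    dist p' x' = dist p x → dist x' q' = dist x q →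
    dist p' y' = dist p y → dist y' r' = dist y r →
    dist x y ≤ dist x' y'

/-- A Hadamard space is a nonempty complete CAT(0) space. -/
structure IsHadamardSpace : Prop where
  nonempty : Nonempty X
  complete : CompleteSpace X
  geodesic : IsGeodesicSpace X
  cat0 : SatisfiesCAT0 X

/-- `δ`-hyperbolicity (slim triangles): each side of each geodesic triangle is contained in the
closed `δ`-neighbourhood of the union of the other two sides. -/
def IsDeltaHyperbolic (δ : ℝ) : Prop :=
  ∀ (x y z : X) (S T U : Set X),
    IsGeodesicSegment x y S → IsGeodesicSegment y z T → IsGeodesicSegment z x U →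
    ∀ p ∈ S, ∃ q ∈ T ∪ U, dist p q ≤ δ

end MetricNotions

section Dimension

variable (X : Type*) [TopologicalSpace X]

/-- The Lebesgue covering dimension of `X` is at most `n`: every finite open cover has an open
refinement such that each point lies in at most `n + 1` of its members. -/
def CoveringDimLE (n : ℕ) : Prop :=
  ∀ 𝒰 : Set (Set X), 𝒰.Finite → (∀ U ∈ 𝒰, IsOpen U) → ⋃₀ 𝒰 = Set.univ →
    ∃ 𝒱 : Set (Set X), (∀ V ∈ 𝒱, IsOpen V) ∧ ⋃₀ 𝒱 = Set.univ ∧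
      (∀ V ∈ 𝒱, ∃ U ∈ 𝒰, V ⊆ U) ∧ ∀ x : X, {V ∈ 𝒱 | x ∈ V}.encard ≤ n + 1

/-- `X` is `n`-dimensional: its Lebesgue covering dimension is exactly `n` (for nonempty `X`). -/
def IsNDimensional (n : ℕ) : Prop :=
  CoveringDimLE X n ∧ ∀ m : ℕ, m < n → ¬ CoveringDimLE X m

end Dimension

/-! ### Sperner's lemma on Kuhn's triangulation of the cube -/

section Sperner

open Finset

/-! Hyperbolicity trades thickness for intersections. If any m ≥ 2 of the convex sets meet, then any
m + 1 of their δ-thickenings meet: cutting three members down by the intersection of the others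
leaves three pairwise intersecting convex sets, and a slim triangle with one side in each has a
point δ-close to all three sides. By the CAT(0) inequality thickenings stay convex, so n rounds lead
from pairs to any n + 2 of the nδ-thickenings (`IsDeltaHyperbolic.hasCommonPoints_thickening`).

Dimension then takes over (`HasCommonPoints.helly`). Given n + 2 convex sets and points p_j lying in
all of them but the j-th, geodesic coning spans a singular simplex whose i-th face lies in the i-th
set. If the face images had no common point, their complements would cover X; a refinement of
multiplicity at most n + 1, pulled back to the cube, would contradict the KKM theorem
`exists_mem_iInter_of_cube_cover`. Only the compact face images have to be closed, not the convex
sets.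

The KKM theorem comes from a mod 2 Sperner lemma, `sum_simplexDet`: label determinants split into
facet terms, interior facets cancel in pairs, and one face of the cube survives for induction on
dimension. -/

/-- The `k`-th vertex of the Kuhn simplex of the unit cell at `c` that belongs to `σ`. -/
def kuhnVertex {d : ℕ} (c : Fin d → ℕ) (σ : Equiv.Perm (Fin d)) (k : ℕ) : Fin d → ℕ :=
  fun j => c j + if (σ.symm j : ℕ) < k then 1 else 0

/-- Adding all rows to row 0 preserves the determinant and turns that row into ones; modulo two the
cofactor signs disappear. This is the boundary formula for simplices. -/
lemma det_succ_eq_sum_minors {d : ℕ} (M : Matrix (Fin (d + 1)) (Fin (d + 1)) (ZMod 2))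
    (hM : ∀ k, ∑ i, M i k = 1) :
    M.det = ∑ k : Fin (d + 1), (M.submatrix Fin.succ k.succAbove).det := by
  have h1 : (M.updateRow 0 (∑ i, (1 : ZMod 2) • M i)).det = (1 : ZMod 2) • M.det :=
    Matrix.det_updateRow_sum M 0 (fun _ => 1)
  rw [one_smul] at h1
  rw [← h1, Matrix.det_succ_row_zero]
  refine Finset.sum_congr rfl fun k _ => ?_
  have h2 : ((-1 : ZMod 2)) = 1 := by decide
  have h3 : (M.updateRow 0 (∑ i, (1 : ZMod 2) • M i)) 0 k = 1 := by
    rw [Matrix.updateRow_self, Finset.sum_apply]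
    refine Eq.trans ?_ (hM k)
    exact Finset.sum_congr rfl fun i _ => congrFun (one_smul _ (M i)) k
  rw [h2, one_pow, h3, one_mul, one_mul]
  congr 1

/-- The determinant of the values of `b` at the vertices of a facet, with the label `0` omitted. -/
def facetDet {d : ℕ} (b : (Fin d → ℕ) → Fin (d + 1) → ZMod 2)
    (c : Fin d → ℕ) (σ : Equiv.Perm (Fin d)) (k : Fin (d + 1)) : ZMod 2 :=
  (Matrix.of fun i l : Fin d => b (kuhnVertex c σ (k.succAbove l)) i.succ).det

/-- The determinant of the values of `b` at the vertices of a Kuhn simplex. -/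
def simplexDet {d : ℕ} (b : (Fin d → ℕ) → Fin (d + 1) → ZMod 2)
    (c : Fin d → ℕ) (σ : Equiv.Perm (Fin d)) : ZMod 2 :=
  (Matrix.of fun i k : Fin (d + 1) => b (kuhnVertex c σ k) i).det

/-- `b` has total mass one on the grid and satisfies Kuhn's boundary conditions. -/
structure IsKuhnLabelling (N : ℕ) {d : ℕ} (b : (Fin d → ℕ) → Fin (d + 1) → ZMod 2) : Prop where
  sum_eq_one : ∀ x : Fin d → ℕ, (∀ j, x j ≤ N) → ∑ i, b x i = 1
  lower : ∀ x : Fin d → ℕ, (∀ j, x j ≤ N) → ∀ j, x j = 0 → b x j.succ = 0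
  upper : ∀ x : Fin d → ℕ, (∀ j, x j ≤ N) → ∀ j, x j = N → ∀ i : Fin (d + 1), (i : ℕ) ≤ j → b x i = 0

lemma kuhnVertex_le {d N : ℕ} {c : Fin d → ℕ} (hc : ∀ j, c j < N) (σ : Equiv.Perm (Fin d))
    (k : ℕ) (j : Fin d) : kuhnVertex c σ k j ≤ N := by
  have := hc j
  unfold kuhnVertex
  split_ifs <;> omega

lemma simplexDet_eq_sum_facetDet {d N : ℕ} {b : (Fin d → ℕ) → Fin (d + 1) → ZMod 2}
    (hb : IsKuhnLabelling N b) {c : Fin d → ℕ} (hc : ∀ j, c j < N) (σ : Equiv.Perm (Fin d)) :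
    simplexDet b c σ = ∑ k, facetDet b c σ k :=
  det_succ_eq_sum_minors _ fun k => by
    simpa using hb.sum_eq_one _ (kuhnVertex_le hc σ k)

lemma facetDet_congr {d : ℕ} (b : (Fin d → ℕ) → Fin (d + 1) → ZMod 2)
    {c c' : Fin d → ℕ} {σ σ' : Equiv.Perm (Fin d)} {k k' : Fin (d + 1)}
    (h : ∀ l, kuhnVertex c σ (k.succAbove l) = kuhnVertex c' σ' (k'.succAbove l)) :
    facetDet b c σ k = facetDet b c' σ' k' := by
  simp only [facetDet, h]

lemma facetDet_eq_zero {d : ℕ} (b : (Fin d → ℕ) → Fin (d + 1) → ZMod 2)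
    {c : Fin d → ℕ} {σ : Equiv.Perm (Fin d)} {k : Fin (d + 1)} (i : Fin d)
    (h : ∀ l, b (kuhnVertex c σ (k.succAbove l)) i.succ = 0) :
    facetDet b c σ k = 0 :=
  Matrix.det_eq_zero_of_row_eq_zero i h

/-- An inner facet is shared with the simplex obtained by a transposition. -/
lemma facetDet_swap {d : ℕ} (b : (Fin d → ℕ) → Fin (d + 1) → ZMod 2)
    (c : Fin d → ℕ) (σ : Equiv.Perm (Fin d)) (k : Fin (d + 1)) (u v : Fin d)
    (hu : (u : ℕ) + 1 = k) (hv : (v : ℕ) = k) :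
    facetDet b c (σ * Equiv.swap u v) k = facetDet b c σ k := by
  refine facetDet_congr b fun l => ?_
  have hl : ((k.succAbove l : Fin (d + 1)) : ℕ) ≠ k := fun h =>
    Fin.succAbove_ne k l (Fin.ext h)
  funext j
  have hs : (σ * Equiv.swap u v).symm j = Equiv.swap u v (σ.symm j) := by
    rw [Equiv.symm_apply_eq]; simp
  unfold kuhnVertex
  rw [hs]
  congr 1
  rcases eq_or_ne (σ.symm j) u with h | h
  · rw [h, Equiv.swap_apply_left]; split_ifs <;> omega
  rcases eq_or_ne (σ.symm j) v with h' | h'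
  · rw [h', Equiv.swap_apply_right]; split_ifs <;> omega
  · rw [Equiv.swap_apply_of_ne_of_ne h h']

/-- The first facet of a simplex is the last facet of a simplex of a neighbouring cell. -/
lemma kuhnVertex_rotate {d : ℕ} (c : Fin (d + 1) → ℕ) (σ : Equiv.Perm (Fin (d + 1)))
    (l : ℕ) (hl : l ≤ d) :
    kuhnVertex (c + Pi.single (σ 0) 1) (σ * finRotate (d + 1)) l = kuhnVertex c σ (l + 1) := by
  funext j
  obtain ⟨m, rfl⟩ := σ.surjective j
  have hs : (σ * finRotate (d + 1)).symm (σ m) = (finRotate (d + 1)).symm m := by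
    rw [Equiv.symm_apply_eq]; simp
  unfold kuhnVertex
  rw [hs, Equiv.symm_apply_apply, Pi.add_apply]
  induction m using Fin.cases with
  | zero =>
    have : (finRotate (d + 1)).symm 0 = Fin.last d := by
      rw [Equiv.symm_apply_eq, finRotate_last]
    rw [this]
    simp only [Pi.single_eq_same, Fin.val_last, Fin.val_zero]
    rw [if_neg (by omega)]
    simp
  | succ m =>
    have : (finRotate (d + 1)).symm m.succ = m.castSucc := by
      rw [Equiv.symm_apply_eq]; simp
    rw [this, Pi.single_eq_of_ne (by simp)]
    simp only [Fin.val_castSucc, Fin.val_succ]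
    split_ifs <;> omega

lemma facetDet_rotate {d : ℕ} (b : (Fin (d + 1) → ℕ) → Fin (d + 2) → ZMod 2)
    (c : Fin (d + 1) → ℕ) (σ : Equiv.Perm (Fin (d + 1))) :
    facetDet b (c + Pi.single (σ 0) 1) (σ * finRotate (d + 1)) (Fin.last _)
      = facetDet b c σ 0 := by
  refine facetDet_congr b fun l => ?_
  rw [Fin.succAbove_last, Fin.succAbove_zero, Fin.val_castSucc, Fin.val_succ]
  exact kuhnVertex_rotate c σ l (by omega)

/-- Exchanging two consecutive coordinate steps changes only the vertex between them, so the
simplices of a cell pair off along this facet and cancel modulo two. -/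
lemma sum_facetDet_inner {d : ℕ} (b : (Fin d → ℕ) → Fin (d + 1) → ZMod 2)
    (c : Fin d → ℕ) (k : Fin (d + 1)) (h0 : k ≠ 0) (hd : k ≠ Fin.last d) :
    ∑ σ, facetDet b c σ k = 0 := by
  have h0' : (k : ℕ) ≠ 0 := fun h => h0 (Fin.ext h)
  have hd' : (k : ℕ) ≠ d := fun h => hd (Fin.ext h)
  have hk := k.isLt
  let u : Fin d := ⟨k - 1, by omega⟩
  let v : Fin d := ⟨k, by omega⟩
  have huv : u ≠ v := fun h => by
    have := congrArg Fin.val h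
    simp only [u, v] at this
    omega
  refine Finset.sum_involution (fun σ _ => σ * Equiv.swap u v) (fun σ _ => ?_)
    (fun σ _ _ h => ?_) (fun _ _ => Finset.mem_univ _) (fun σ _ => ?_)
  · rw [facetDet_swap b c σ k u v (by simp only [u]; omega) rfl, CharTwo.add_self_eq_zero]
  · rw [mul_eq_left, Equiv.swap_eq_one_iff] at h
    exact huv h
  · rw [mul_assoc, Equiv.swap_mul_self, mul_one]

/-- The extended permutation moves coordinate 0 first. From then on that coordinate stays at its
upper value and the rest is a Kuhn path one dimension lower. -/
lemma kuhnVertex_cons {d : ℕ} (N : ℕ) (c : Fin d → ℕ) (σ : Equiv.Perm (Fin d)) (k : ℕ) :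
    kuhnVertex (Fin.cons N c : Fin (d + 1) → ℕ) (Equiv.Perm.decomposeFin.symm (0, σ)) (k + 1)
      = (Fin.cons (N + 1) (kuhnVertex c σ k) : Fin (d + 1) → ℕ) := by
  funext j
  have h0 : (Equiv.Perm.decomposeFin.symm (0, σ)).symm 0 = 0 := by
    rw [Equiv.symm_apply_eq]; simp
  have hs : ∀ i, (Equiv.Perm.decomposeFin.symm (0, σ)).symm (Fin.succ i) = (σ.symm i).succ := by
    intro i
    rw [Equiv.symm_apply_eq]; simp
  unfold kuhnVertex
  induction j using Fin.cases with
  | zero => rw [h0]; simp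
  | succ j => rw [hs]; simp

/-- The labelling induced on the facet of the cube where the first coordinate is `N`. -/
lemma IsKuhnLabelling.restrict {N d : ℕ} {b : (Fin (d + 1) → ℕ) → Fin (d + 2) → ZMod 2}
    (hb : IsKuhnLabelling N b) :
    IsKuhnLabelling N fun (x : Fin d → ℕ) i => b (Fin.cons N x) i.succ := by
  have hle : ∀ x : Fin d → ℕ, (∀ j, x j ≤ N) → ∀ j, (Fin.cons N x : Fin (d + 1) → ℕ) j ≤ N := by
    intro x hx j
    induction j using Fin.cases with
    | zero => simp
    | succ j => simpa using hx j
  refine ⟨fun x hx => ?_, fun x hx j hj => ?_, fun x hx j hj i hi => ?_⟩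
  · have := hb.sum_eq_one _ (hle x hx)
    rwa [Fin.sum_univ_succ, hb.upper _ (hle x hx) 0 rfl 0 (by simp), zero_add] at this
  · exact hb.lower _ (hle x hx) j.succ (by simpa using hj)
  · exact hb.upper _ (hle x hx) j.succ (by simpa using hj) i.succ (by simpa using hi)

lemma facetDet_zero_cons {d : ℕ} (b : (Fin (d + 1) → ℕ) → Fin (d + 2) → ZMod 2) (N : ℕ)
    (c : Fin d → ℕ) (σ : Equiv.Perm (Fin d)) :
    facetDet b (Fin.cons N c : Fin (d + 1) → ℕ) (Equiv.Perm.decomposeFin.symm (0, σ)) 0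
      = simplexDet (fun (x : Fin d → ℕ) i => b (Fin.cons (N + 1) x) i.succ) c σ := by
  simp only [facetDet, simplexDet, Fin.succAbove_zero, Fin.val_succ, kuhnVertex_cons]

/-- The cells of the grid of side `N`. -/
def gridCells (d N : ℕ) : Finset (Fin d → ℕ) := Fintype.piFinset fun _ => range N

lemma mem_gridCells {d N : ℕ} {c : Fin d → ℕ} : c ∈ gridCells d N ↔ ∀ j, c j < N := by
  simp [gridCells]

/-- Facets in the interior of the cube cancel. -/
lemma sum_facetDet_first_eq_last {N d : ℕ} (b : (Fin (d + 1) → ℕ) → Fin (d + 2) → ZMod 2) :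
    ∑ p ∈ (gridCells (d + 1) N ×ˢ (univ : Finset (Equiv.Perm (Fin (d + 1))))) with
        p.1 (p.2 0) + 1 ≠ N, facetDet b p.1 p.2 0
      = ∑ p ∈ (gridCells (d + 1) N ×ˢ (univ : Finset (Equiv.Perm (Fin (d + 1))))) with
        p.1 (p.2 (Fin.last d)) ≠ 0, facetDet b p.1 p.2 (Fin.last _) := by
  refine Finset.sum_nbij'
    (fun p => (p.1 + Pi.single (p.2 0) 1, p.2 * finRotate (d + 1)))
    (fun p => (p.1 - Pi.single (p.2 (Fin.last d)) 1, p.2 * (finRotate (d + 1))⁻¹))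
    (fun p hp => ?_) (fun p hp => ?_) (fun p hp => ?_) (fun p hp => ?_) (fun p hp => ?_)
  · simp only [mem_filter, mem_product, mem_univ, and_true, mem_gridCells] at hp ⊢
    refine ⟨fun j => ?_, by simp⟩
    rcases eq_or_ne j (p.2 0) with rfl | h
    · have := hp.1 (p.2 0)
      simp only [Pi.add_apply, Pi.single_eq_same]
      omega
    · simpa [Pi.single_eq_of_ne h] using hp.1 j
  · simp only [mem_filter, mem_product, mem_univ, and_true, mem_gridCells] at hp ⊢
    have h0 : (p.2 * (finRotate (d + 1))⁻¹) 0 = p.2 (Fin.last d) := by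
      rw [Equiv.Perm.mul_apply, Equiv.Perm.inv_def]
      exact congrArg p.2 ((Equiv.symm_apply_eq _).2 finRotate_last.symm)
    refine ⟨fun j => lt_of_le_of_lt (Nat.sub_le _ _) (hp.1 j), ?_⟩
    rw [h0]
    have := hp.1 (p.2 (Fin.last d))
    have := hp.2
    simp only [Pi.sub_apply, Pi.single_eq_same]
    omega
  · refine Prod.ext ?_ (by simp)
    funext j
    simp
  · simp only [mem_filter, mem_product, mem_univ, and_true, mem_gridCells] at hp
    have h0 : (p.2 * (finRotate (d + 1))⁻¹) 0 = p.2 (Fin.last d) := by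
      rw [Equiv.Perm.mul_apply, Equiv.Perm.inv_def]
      exact congrArg p.2 ((Equiv.symm_apply_eq _).2 finRotate_last.symm)
    refine Prod.ext ?_ (by simp)
    funext j
    simp only [h0, Pi.add_apply, Pi.sub_apply]
    rcases eq_or_ne j (p.2 (Fin.last d)) with rfl | h
    · have := hp.2
      simp only [Pi.single_eq_same]
      omega
    · simp [Pi.single_eq_of_ne h]
  · exact (facetDet_rotate b p.1 p.2).symm

/-- Coordinate `σ (Fin.last d)` moves only in the final step, so it is still 0 on this facet and the
corresponding label is forbidden. -/
lemma facetDet_last_eq_zero {N d : ℕ} {b : (Fin (d + 1) → ℕ) → Fin (d + 2) → ZMod 2}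
    (hb : IsKuhnLabelling N b) {c : Fin (d + 1) → ℕ} (hc : ∀ j, c j < N)
    (σ : Equiv.Perm (Fin (d + 1))) (h : c (σ (Fin.last d)) = 0) :
    facetDet b c σ (Fin.last _) = 0 := by
  refine facetDet_eq_zero b (σ (Fin.last d)) fun l => ?_
  refine hb.lower _ (kuhnVertex_le hc σ _) _ ?_
  unfold kuhnVertex
  rw [h, Equiv.symm_apply_apply, if_neg]
  simp only [Fin.succAbove_last, Fin.val_castSucc, Fin.val_last]
  omega

/-- Coordinate `σ 0` has already reached N on this facet. As it is not coordinate 0, label 1 is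
forbidden there and the first row vanishes. -/
lemma facetDet_first_eq_zero {N d : ℕ} {b : (Fin (d + 1) → ℕ) → Fin (d + 2) → ZMod 2}
    (hb : IsKuhnLabelling N b) {c : Fin (d + 1) → ℕ} (hc : ∀ j, c j < N)
    (σ : Equiv.Perm (Fin (d + 1))) (h : c (σ 0) + 1 = N) (h0 : σ 0 ≠ 0) :
    facetDet b c σ 0 = 0 := by
  refine facetDet_eq_zero b 0 fun l => ?_
  refine hb.upper _ (kuhnVertex_le hc σ _) (σ 0) ?_ _ ?_
  · unfold kuhnVertex
    rw [Equiv.symm_apply_apply, if_pos, h]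
    simp
  · have : ((σ 0 : Fin (d + 1)) : ℕ) ≠ 0 := fun h => h0 (Fin.ext h)
    simp only [Fin.succ_zero_eq_one, Fin.val_one]
    omega

/-- The only boundary face that contributes is the one where coordinate 0 is maximal: there the
boundary condition on that coordinate excludes just label 0, which the facet determinant omits. -/
lemma sum_facetDet_boundary {N d : ℕ} {b : (Fin (d + 1) → ℕ) → Fin (d + 2) → ZMod 2}
    (hb : IsKuhnLabelling (N + 1) b) :
    ∑ p ∈ (gridCells (d + 1) (N + 1) ×ˢ (univ : Finset (Equiv.Perm (Fin (d + 1))))) with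
        p.1 (p.2 0) + 1 = N + 1, facetDet b p.1 p.2 0
      = ∑ p ∈ gridCells d (N + 1) ×ˢ (univ : Finset (Equiv.Perm (Fin d))),
        simplexDet (fun (x : Fin d → ℕ) i => b (Fin.cons (N + 1) x) i.succ) p.1 p.2 := by
  symm
  refine Finset.sum_of_injOn
    (fun p => ((Fin.cons N p.1 : Fin (d + 1) → ℕ), Equiv.Perm.decomposeFin.symm (0, p.2)))
    ?_ ?_ ?_ ?_
  · intro p _ q _ h
    have h1 := (Prod.ext_iff.1 h).1
    have h2 := Equiv.injective _ (Prod.ext_iff.1 h).2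
    exact Prod.ext (Fin.cons_right_injective (α := fun _ => ℕ) N h1) (Prod.ext_iff.1 h2).2
  · intro p hp
    simp only [coe_filter, mem_product, mem_univ, and_true, mem_gridCells, Set.mem_ofPred_eq,
      coe_product, Set.mem_prod, mem_coe] at hp ⊢
    refine ⟨fun j => ?_, by simp⟩
    induction j using Fin.cases with
    | zero => simp
    | succ j => simpa using hp j
  · rintro ⟨c, σ⟩ hp hn
    simp only [mem_filter, mem_product, mem_univ, and_true, mem_gridCells] at hp
    refine facetDet_first_eq_zero hb hp.1 σ hp.2 fun h0 => hn ?_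
    obtain ⟨⟨q, e⟩, rfl⟩ := Equiv.Perm.decomposeFin.symm.surjective σ
    rw [Equiv.Perm.decomposeFin_symm_apply_zero] at h0
    subst h0
    refine ⟨(Fin.tail c, e), ?_, ?_⟩
    · simp only [coe_product, Set.mem_prod, mem_coe, mem_gridCells, mem_univ, and_true]
      exact fun j => hp.1 _
    · refine Prod.ext ?_ rfl
      have hc : c 0 = N := by simpa using hp.2
      simp only [← hc, Fin.cons_self_tail]
  · intro p _
    exact (facetDet_zero_cons b N p.1 p.2).symm

/-- **Sperner's lemma** modulo two. -/
theorem sum_simplexDet {N : ℕ} (d : ℕ) (b : (Fin d → ℕ) → Fin (d + 1) → ZMod 2)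
    (hb : IsKuhnLabelling (N + 1) b) :
    ∑ p ∈ gridCells d (N + 1) ×ˢ (univ : Finset (Equiv.Perm (Fin d))),
      simplexDet b p.1 p.2 = 1 := by
  induction d with
  | zero =>
    have h1 : gridCells 0 (N + 1) = {0} := by
      ext c
      simp [mem_gridCells, Subsingleton.elim c 0]
    have h2 : ∀ x, b x 0 = 1 := fun x => by
      simpa using hb.sum_eq_one x (fun j => j.elim0)
    rw [h1, Finset.univ_unique, Finset.singleton_product_singleton, Finset.sum_singleton]
    simp [simplexDet, h2]
  | succ d ih =>
    rw [← ih _ hb.restrict, ← sum_facetDet_boundary hb]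
    set P := gridCells (d + 1) (N + 1) ×ˢ (univ : Finset (Equiv.Perm (Fin (d + 1)))) with hP
    have hlast : ∑ p ∈ P, facetDet b p.1 p.2 (Fin.last _)
        = ∑ p ∈ P with p.1 (p.2 0) + 1 ≠ N + 1, facetDet b p.1 p.2 0 := by
      rw [sum_facetDet_first_eq_last, Finset.sum_filter_of_ne]
      intro p hp hne h
      simp only [mem_product, mem_univ, and_true, mem_gridCells] at hp
      exact hne (facetDet_last_eq_zero hb hp p.2 h)
    have hinner : ∀ k : Fin d, ∑ p ∈ P, facetDet b p.1 p.2 k.castSucc.succ = 0 := by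
      intro k
      rw [hP, Finset.sum_product]
      refine Finset.sum_eq_zero fun c _ => sum_facetDet_inner b c _ (Fin.succ_ne_zero _) ?_
      rw [← Fin.succ_last]
      exact fun h => (Fin.castSucc_lt_last k).ne (Fin.succ_injective _ h)
    have hsum : ∑ p ∈ P, simplexDet b p.1 p.2 = ∑ k, ∑ p ∈ P, facetDet b p.1 p.2 k := by
      rw [Finset.sum_comm]
      refine Finset.sum_congr rfl fun p hp => ?_
      simp only [hP, mem_product, mem_univ, and_true, mem_gridCells] at hp
      exact simplexDet_eq_sum_facetDet hb hp p.2
    -- Inner facets vanish; the last facets equal the first facets off the upper boundary and cancel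
    -- them modulo two, leaving the first facets on the boundary.
    rw [hsum, Fin.sum_univ_succ, Fin.sum_univ_castSucc, Finset.sum_eq_zero fun k _ => hinner k,
      zero_add, Fin.succ_last, hlast,
      ← Finset.sum_filter_add_sum_filter_not P (fun p => p.1 (p.2 0) + 1 = N + 1), add_assoc,
      CharTwo.add_self_eq_zero, add_zero]

/-- **Sperner's lemma** for Kuhn's labellings of the cube: some cell carries all labels. -/
theorem exists_cell_all_labels {N d : ℕ} (ℓ : (Fin d → ℕ) → Fin (d + 1))
    (hlow : ∀ x : Fin d → ℕ, (∀ j, x j ≤ N + 1) → ∀ j, x j = 0 → ℓ x ≠ j.succ)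
    (hup : ∀ x : Fin d → ℕ, (∀ j, x j ≤ N + 1) → ∀ j, x j = N + 1 → (j : ℕ) < ℓ x) :
    ∃ c : Fin d → ℕ, (∀ j, c j < N + 1) ∧
      ∀ i, ∃ x : Fin d → ℕ, (∀ j, c j ≤ x j ∧ x j ≤ c j + 1) ∧ ℓ x = i := by
  let b : (Fin d → ℕ) → Fin (d + 1) → ZMod 2 := fun x i => if ℓ x = i then 1 else 0
  have hb : IsKuhnLabelling (N + 1) b := by
    refine ⟨fun x _ => by simp [b], fun x hx j hj => if_neg (hlow x hx j hj),
      fun x hx j hj i hi => if_neg fun h => ?_⟩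
    have := hup x hx j hj
    rw [h] at this
    omega
  obtain ⟨⟨c, σ⟩, hp, hne⟩ : ∃ p ∈ gridCells d (N + 1) ×ˢ (univ : Finset (Equiv.Perm (Fin d))),
      simplexDet b p.1 p.2 ≠ 0 := by
    refine Finset.exists_ne_zero_of_sum_ne_zero ?_
    rw [sum_simplexDet d b hb]
    exact one_ne_zero
  simp only [mem_product, mem_univ, and_true, mem_gridCells] at hp
  refine ⟨c, hp, fun i => ?_⟩
  by_contra! h
  -- A label absent from the cell would give a zero row.
  refine hne (Matrix.det_eq_zero_of_row_eq_zero i fun k => ?_)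
  refine if_neg (h _ fun j => ?_)
  simp only [kuhnVertex]
  split_ifs <;> omega

/-- Lebesgue's covering theorem for the cube, in the form of Knaster, Kuratowski and Mazurkiewicz. -/
theorem exists_mem_iInter_of_cube_cover {d : ℕ} (W : Fin (d + 1) → Set (Fin d → ℝ))
    (hopen : ∀ i, IsOpen (W i)) (hcover : Set.Icc 0 1 ⊆ ⋃ i, W i)
    (hlow : ∀ x ∈ Set.Icc (0 : Fin d → ℝ) 1, ∀ j, x j = 0 → x ∉ W j.succ)
    (hup : ∀ x ∈ Set.Icc (0 : Fin d → ℝ) 1, ∀ j, x j = 1 →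
      ∀ i : Fin (d + 1), (i : ℕ) ≤ j → x ∉ W i) :
    ∃ x ∈ Set.Icc (0 : Fin d → ℝ) 1, ∀ i, x ∈ W i := by
  obtain ⟨ε, hε, hball⟩ := lebesgue_number_lemma_of_metric isCompact_Icc hopen hcover
  obtain ⟨N, hN⟩ := exists_nat_one_div_lt hε
  have hN0 : (0 : ℝ) < N + 1 := by positivity
  let φ : (Fin d → ℕ) → Fin d → ℝ := fun g j => g j / (N + 1)
  have hφ : ∀ g : Fin d → ℕ, (∀ j, g j ≤ N + 1) → φ g ∈ Set.Icc (0 : Fin d → ℝ) 1 := by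
    intro g hg
    refine ⟨fun j => by simp only [φ, Pi.zero_apply]; positivity, fun j => ?_⟩
    simp only [φ, Pi.one_apply]
    rw [div_le_one hN0]
    exact_mod_cast hg j
  have hlab : ∀ g : Fin d → ℕ, ∃ i, (∀ j, g j ≤ N + 1) → Metric.ball (φ g) ε ⊆ W i := by
    intro g
    by_cases hg : ∀ j, g j ≤ N + 1
    · obtain ⟨i, hi⟩ := hball _ (hφ g hg)
      exact ⟨i, fun _ => hi⟩
    · exact ⟨0, fun h => absurd h hg⟩
  -- A grid point is labelled by a set containing its whole ε-ball. Cells have sup-diameter below ε,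
  -- so a corner of a fully labelled cell lies in every `W i`, without a limit argument.
  choose ℓ hℓ using hlab
  obtain ⟨c, hc, hcl⟩ := exists_cell_all_labels (N := N) ℓ
    (fun g hg j hj h => hlow _ (hφ g hg) j (by simp [φ, hj])
      (h ▸ hℓ g hg (Metric.mem_ball_self hε)))
    (fun g hg j hj => by
      by_contra h
      refine hup _ (hφ g hg) j ?_ (ℓ g) (by omega) (hℓ g hg (Metric.mem_ball_self hε))
      simp only [φ, hj]
      push_cast
      exact div_self hN0.ne')
  refine ⟨φ c, hφ c fun j => (hc j).le, fun i => ?_⟩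
  obtain ⟨g, hg, rfl⟩ := hcl i
  refine hℓ g (fun j => (hg j).2.trans (hc j)) ?_
  rw [Metric.mem_ball]
  refine lt_of_le_of_lt ((dist_pi_le_iff (by positivity)).2 fun j => ?_) hN
  simp only [φ]
  have h1 : (c j : ℝ) ≤ g j := by exact_mod_cast (hg j).1
  have h2 : (g j : ℝ) ≤ c j + 1 := by exact_mod_cast (hg j).2
  rw [Real.dist_eq, ← sub_div, abs_div, abs_of_pos hN0]
  gcongr
  rw [abs_le]
  constructor <;> linarith

end Sperner

/-! ### Convexity of the metric of a CAT(0) space -/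

section CAT0

variable {X : Type*} [MetricSpace X]

/-- A Euclidean triangle with prescribed side lengths. -/
lemma exists_comparison_triangle {a b c : ℝ} (ha : 0 ≤ a) (hb : 0 ≤ b) (hc : 0 ≤ c)
    (hab : a ≤ b + c) (hba : b ≤ a + c) (hcab : c ≤ a + b) :
    ∃ p q r : EuclideanSpace ℝ (Fin 2), dist p q = a ∧ dist p r = b ∧ dist q r = c := by
  rcases ha.eq_or_lt with rfl | ha'
  · refine ⟨0, 0, !₂[b, 0], by simp, ?_, ?_⟩
    · simp [EuclideanSpace.dist_eq, Real.dist_eq, Real.sqrt_sq hb]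
    · have : b = c := by linarith
      simp [EuclideanSpace.dist_eq, Real.dist_eq, this, Real.sqrt_sq hc]
  -- By the law of cosines, `u` is the coordinate of the third vertex along the side of length `a`.
  · set u := (a ^ 2 + b ^ 2 - c ^ 2) / (2 * a) with hu
    have hua : 2 * a * u = a ^ 2 + b ^ 2 - c ^ 2 := by rw [hu]; field_simp
    have hub : u ^ 2 ≤ b ^ 2 := by
      rw [sq_le_sq, abs_of_nonneg hb, abs_le]
      constructor
      · rw [hu, le_div_iff₀ (by positivity)]
        nlinarith
      · rw [hu, div_le_iff₀ (by positivity)]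
        nlinarith
    have hv : Real.sqrt (b ^ 2 - u ^ 2) ^ 2 = b ^ 2 - u ^ 2 := Real.sq_sqrt (by linarith)
    refine ⟨0, !₂[a, 0], !₂[u, Real.sqrt (b ^ 2 - u ^ 2)], ?_, ?_, ?_⟩
    · simp [EuclideanSpace.dist_eq, Real.dist_eq, Real.sqrt_sq ha]
    · rw [EuclideanSpace.dist_eq, Real.sqrt_eq_iff_mul_self_eq (by positivity) hb]
      simp only [Fin.sum_univ_two, Real.dist_eq, sq_abs]
      simp
      nlinarith
    · rw [EuclideanSpace.dist_eq, Real.sqrt_eq_iff_mul_self_eq (by positivity) hc]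
      simp only [Fin.sum_univ_two, Real.dist_eq, sq_abs]
      simp
      nlinarith

/-! ### Comparison of distances along geodesics -/

namespace IsGeodesicFrom

variable {γ γ' : ℝ → X} {x y x' y' : X} {t s : ℝ}

lemma mul_mem (ht : t ∈ Set.Icc (0 : ℝ) 1) (x y : X) :
    t * dist x y ∈ Set.Icc 0 (dist x y) :=
  ⟨mul_nonneg ht.1 dist_nonneg, mul_le_of_le_one_left dist_nonneg ht.2⟩

lemma isGeodesicSegment (h : IsGeodesicFrom γ x y) :
    IsGeodesicSegment x y (γ '' Set.Icc 0 (dist x y)) :=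
  ⟨γ, h, rfl⟩

lemma dist_left (h : IsGeodesicFrom γ x y) (ht : t ∈ Set.Icc (0 : ℝ) 1) :
    dist x (γ (t * dist x y)) = t * dist x y := by
  have := h.isometric 0 ⟨le_rfl, dist_nonneg⟩ _ (mul_mem ht x y)
  rwa [zero_sub, abs_neg, abs_of_nonneg (mul_mem ht x y).1, h.source] at this

lemma dist_right (h : IsGeodesicFrom γ x y) (ht : t ∈ Set.Icc (0 : ℝ) 1) :
    dist (γ (t * dist x y)) y = (1 - t) * dist x y := by
  have := h.isometric _ (mul_mem ht x y) _ ⟨dist_nonneg, le_rfl⟩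
  rw [h.target, abs_of_nonpos (sub_nonpos.2 (mul_mem ht x y).2)] at this
  rw [this]
  ring

lemma dist_param (h : IsGeodesicFrom γ x y) (ht : t ∈ Set.Icc (0 : ℝ) 1)
    (hs : s ∈ Set.Icc (0 : ℝ) 1) :
    dist (γ (t * dist x y)) (γ (s * dist x y)) = |t - s| * dist x y := by
  rw [h.isometric _ (mul_mem ht x y) _ (mul_mem hs x y), ← sub_mul, abs_mul,
    abs_of_nonneg (dist_nonneg (x := x) (y := y))]

lemma reverse (h : IsGeodesicFrom γ x y) : IsGeodesicFrom (fun t => γ (dist x y - t)) y x := by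
  refine ⟨?_, ?_, fun s hs t ht => ?_⟩
  · simp [h.target]
  · simp [dist_comm y x, h.source]
  · rw [dist_comm y x] at hs ht
    rw [h.isometric _ ⟨by linarith [hs.2], by linarith [hs.1]⟩ _
      ⟨by linarith [ht.2], by linarith [ht.1]⟩, ← abs_neg]
    congr 1
    ring

lemma continuousOn (h : IsGeodesicFrom γ x y) : ContinuousOn γ (Set.Icc 0 (dist x y)) := by
  refine LipschitzOnWith.continuousOn (K := 1) (LipschitzOnWith.of_dist_le_mul fun s hs t ht => ?_)
  rw [h.isometric s hs t ht, Real.dist_eq, NNReal.coe_one, one_mul]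

lemma dist_le_of_source_eq (hcat : SatisfiesCAT0 X) {p : X} (h : IsGeodesicFrom γ p x)
    (h' : IsGeodesicFrom γ' p y) (ht : t ∈ Set.Icc (0 : ℝ) 1) :
    dist (γ (t * dist p x)) (γ' (t * dist p y)) ≤ t * dist x y := by
  obtain ⟨p', q', r', hpq, hpr, hqr⟩ := exists_comparison_triangle
    (dist_nonneg (x := p) (y := x)) (dist_nonneg (x := p) (y := y)) (dist_nonneg (x := x) (y := y))
    (by rw [dist_comm x y]; exact dist_triangle _ _ _) (dist_triangle _ _ _)
    (dist_triangle_left _ _ _)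
  have e1 : ∀ q' : EuclideanSpace ℝ (Fin 2), dist p' (AffineMap.lineMap p' q' t) = t * dist p' q' :=
    fun q' => by rw [dist_left_lineMap, Real.norm_eq_abs, abs_of_nonneg ht.1]
  have e2 : ∀ q' : EuclideanSpace ℝ (Fin 2),
      dist (AffineMap.lineMap p' q' t) q' = (1 - t) * dist p' q' :=
    fun q' => by rw [dist_lineMap_right, Real.norm_eq_abs, abs_of_nonneg (sub_nonneg.2 ht.2)]
  refine (hcat p x y _ _ h.isGeodesicSegment h'.isGeodesicSegment
    _ ⟨_, mul_mem ht p x, rfl⟩ _ ⟨_, mul_mem ht p y, rfl⟩ p' q' r'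
    (AffineMap.lineMap p' q' t) (AffineMap.lineMap p' r' t) hpq hqr hpr
    ?_ ?_ ?_ ?_).trans_eq ?_
  · rw [e1, h.dist_left ht, hpq]
  · rw [e2, h.dist_right ht, hpq]
  · rw [e1, h'.dist_left ht, hpr]
  · rw [e2, h'.dist_right ht, hpr]
  · rw [← hqr, dist_eq_norm, dist_eq_norm, AffineMap.lineMap_apply_module,
      AffineMap.lineMap_apply_module, add_sub_add_left_eq_sub, ← smul_sub, norm_smul,
      Real.norm_eq_abs, abs_of_nonneg ht.1]

lemma dist_le_of_target_eq (hcat : SatisfiesCAT0 X) {p : X} (h : IsGeodesicFrom γ x p)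
    (h' : IsGeodesicFrom γ' y p) (ht : t ∈ Set.Icc (0 : ℝ) 1) :
    dist (γ (t * dist x p)) (γ' (t * dist y p)) ≤ (1 - t) * dist x y := by
  have ht' : 1 - t ∈ Set.Icc (0 : ℝ) 1 := ⟨by linarith [ht.2], by linarith [ht.1]⟩
  convert dist_le_of_source_eq hcat h.reverse h'.reverse ht' using 3
  · rw [dist_comm p x]; ring
  · rw [dist_comm p y]; ring

/-- The metric of a CAT(0) space is convex. -/
lemma dist_le (hgeo : IsGeodesicSpace X) (hcat : SatisfiesCAT0 X) (h : IsGeodesicFrom γ x y)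
    (h' : IsGeodesicFrom γ' x' y') (ht : t ∈ Set.Icc (0 : ℝ) 1) :
    dist (γ (t * dist x y)) (γ' (t * dist x' y')) ≤ (1 - t) * dist x x' + t * dist y y' := by
  -- The diagonal splits the quadrilateral into two triangles, each with a shared endpoint.
  obtain ⟨_, η, hη, -⟩ := hgeo x y'
  have h1 := dist_le_of_source_eq hcat h hη ht
  have h2 := dist_le_of_target_eq hcat hη h' ht
  linarith [dist_triangle (γ (t * dist x y)) (η (t * dist x y')) (γ' (t * dist x' y'))]

lemma exists_param (t : ℝ) (ht : t ∈ Set.Icc 0 (dist x y)) :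
    ∃ s ∈ Set.Icc (0 : ℝ) 1, s * dist x y = t := by
  rcases (dist_nonneg (x := x) (y := y)).eq_or_lt with h0 | h0
  · refine ⟨0, by simp, ?_⟩
    have := ht.1
    have := ht.2
    linarith
  · exact ⟨t / dist x y, ⟨div_nonneg ht.1 h0.le, (div_le_one h0).2 ht.2⟩, div_mul_cancel₀ _ h0.ne'⟩

end IsGeodesicFrom

/-! ### Thickenings, convex sets and geodesic interpolation -/

/-- The set of points at distance at most `r` from some point of `B`. -/
def thickening (r : ℝ) (B : Set X) : Set X := {x | ∃ b ∈ B, dist x b ≤ r}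

lemma IsGeodesicallyConvex.thickening (hgeo : IsGeodesicSpace X) (hcat : SatisfiesCAT0 X)
    {B : Set X} (hB : IsGeodesicallyConvex B) (r : ℝ) :
    IsGeodesicallyConvex (thickening r B) := by
  rintro x ⟨x', hx', hxr⟩ y ⟨y', hy', hyr⟩ _ ⟨γ, hγ, rfl⟩ _ ⟨u, hu, rfl⟩
  obtain ⟨t, ht, rfl⟩ := IsGeodesicFrom.exists_param u hu
  obtain ⟨_, η, hη, -⟩ := hgeo x' y'
  refine ⟨η (t * dist x' y'), hB x' hx' y' hy' _ hη.isGeodesicSegment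
    ⟨_, IsGeodesicFrom.mul_mem ht _ _, rfl⟩, ?_⟩
  refine (hγ.dist_le hgeo hcat hη ht).trans ?_
  have := mul_le_mul_of_nonneg_left hxr (sub_nonneg.2 ht.2)
  have := mul_le_mul_of_nonneg_left hyr ht.1
  linarith

lemma IsGeodesicallyConvex.inter {A B : Set X} (hA : IsGeodesicallyConvex A)
    (hB : IsGeodesicallyConvex B) : IsGeodesicallyConvex (A ∩ B) :=
  fun x hx y hy S hS => Set.subset_inter (hA x hx.1 y hy.1 S hS) (hB x hx.2 y hy.2 S hS)

lemma IsGeodesicallyConvex.biInter {ι : Type*} {s : Set ι} {B : ι → Set X}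
    (hB : ∀ i ∈ s, IsGeodesicallyConvex (B i)) : IsGeodesicallyConvex (⋂ i ∈ s, B i) :=
  fun x hx y hy S hS => Set.subset_iInter₂ fun i hi =>
    hB i hi x (Set.mem_iInter₂.1 hx i hi) y (Set.mem_iInter₂.1 hy i hi) S hS

lemma IsGeodesicSpace.exists_isGeodesicFrom (hgeo : IsGeodesicSpace X) (x y : X) :
    ∃ γ : ℝ → X, IsGeodesicFrom γ x y :=
  let ⟨_, γ, hγ, _⟩ := hgeo x y
  ⟨γ, hγ⟩

/-- The point that divides a chosen geodesic from `x` to `y` in the ratio `t : 1 - t`, where `t` is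
clamped to the unit interval. -/
noncomputable def geodesicPoint (hgeo : IsGeodesicSpace X) (x y : X) (t : ℝ) : X :=
  (hgeo.exists_isGeodesicFrom x y).choose ((Set.projIcc (0 : ℝ) 1 zero_le_one t : ℝ) * dist x y)

lemma geodesicPoint_zero (hgeo : IsGeodesicSpace X) (x y : X) : geodesicPoint hgeo x y 0 = x := by
  rw [geodesicPoint, Set.projIcc_left, zero_mul]
  exact (hgeo.exists_isGeodesicFrom x y).choose_spec.source

lemma geodesicPoint_one (hgeo : IsGeodesicSpace X) (x y : X) : geodesicPoint hgeo x y 1 = y := by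
  rw [geodesicPoint, Set.projIcc_right, one_mul]
  exact (hgeo.exists_isGeodesicFrom x y).choose_spec.target

lemma IsGeodesicallyConvex.geodesicPoint_mem (hgeo : IsGeodesicSpace X) {A : Set X}
    (hA : IsGeodesicallyConvex A) {x y : X} (hx : x ∈ A) (hy : y ∈ A) (t : ℝ) :
    geodesicPoint hgeo x y t ∈ A :=
  hA x hx y hy _ (hgeo.exists_isGeodesicFrom x y).choose_spec.isGeodesicSegment
    ⟨_, IsGeodesicFrom.mul_mem (Set.projIcc (0 : ℝ) 1 zero_le_one t).2 x y, rfl⟩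

/-- First change the parameter on one geodesic, then compare both geodesics at the same parameter;
clamping is 1-Lipschitz. This gives joint continuity of the coning. -/
lemma dist_geodesicPoint_le (hgeo : IsGeodesicSpace X) (hcat : SatisfiesCAT0 X)
    (x y x' y' : X) (t t' : ℝ) :
    dist (geodesicPoint hgeo x y t) (geodesicPoint hgeo x' y' t')
      ≤ dist x x' + dist y y' + |t - t'| * dist x y := by
  have hγ := (hgeo.exists_isGeodesicFrom x y).choose_spec
  have hγ' := (hgeo.exists_isGeodesicFrom x' y').choose_spec
  set s := Set.projIcc (0 : ℝ) 1 zero_le_one t with hs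
  set s' := Set.projIcc (0 : ℝ) 1 zero_le_one t' with hs'
  have h1 := hγ.dist_param s.2 s'.2
  have h2 := hγ.dist_le hgeo hcat hγ' s'.2
  have h3 : |(s : ℝ) - s'| ≤ |t - t'| := by
    simpa [Real.dist_eq, Subtype.dist_eq] using
      (LipschitzWith.projIcc (zero_le_one (α := ℝ))).dist_le_mul t t'
  have h4 := mul_le_mul_of_nonneg_right h3 (dist_nonneg (x := x) (y := y))
  have h5 : (1 - (s' : ℝ)) * dist x x' ≤ dist x x' :=
    mul_le_of_le_one_left dist_nonneg (by linarith [s'.2.1])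
  have h6 : (s' : ℝ) * dist y y' ≤ dist y y' := mul_le_of_le_one_left dist_nonneg s'.2.2
  have h7 := dist_triangle (geodesicPoint hgeo x y t)
    ((hgeo.exists_isGeodesicFrom x y).choose ((s' : ℝ) * dist x y)) (geodesicPoint hgeo x' y' t')
  simp only [geodesicPoint, ← hs, ← hs'] at h7 ⊢
  linarith

lemma Continuous.geodesicPoint (hgeo : IsGeodesicSpace X) (hcat : SatisfiesCAT0 X)
    {T : Type*} [TopologicalSpace T] {f g : T → X} {τ : T → ℝ}
    (hf : Continuous f) (hg : Continuous g) (hτ : Continuous τ) :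
    Continuous fun a => geodesicPoint hgeo (f a) (g a) (τ a) := by
  refine continuous_iff_continuousAt.2 fun a => tendsto_iff_dist_tendsto_zero.2 ?_
  refine squeeze_zero (g := fun b => dist (f b) (f a) + dist (g b) (g a)
    + |τ b - τ a| * dist (f b) (g b)) (fun _ => dist_nonneg)
    (fun b => dist_geodesicPoint_le hgeo hcat _ _ _ _ _ _) ?_
  have : Continuous fun b => dist (f b) (f a) + dist (g b) (g a)
    + |τ b - τ a| * dist (f b) (g b) := by fun_prop
  simpa using this.tendsto a

end CAT0

/-! ### Helly's theorem in CAT(0) spaces of finite covering dimension -/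

section Helly

variable {X : Type*}

/-- Every at most `m` members of the family `C` have a common point. -/
def HasCommonPoints {ι : Type*} (m : ℕ) (C : ι → Set X) : Prop :=
  ∀ s : Finset ι, s.card ≤ m → (⋂ i ∈ s, C i).Nonempty

lemma HasCommonPoints.mono {ι : Type*} {m : ℕ} {C D : ι → Set X} (h : HasCommonPoints m C)
    (hCD : ∀ i, C i ⊆ D i) : HasCommonPoints m D :=
  fun s hs => (h s hs).mono (Set.iInter₂_mono fun i _ => hCD i)

lemma HasCommonPoints.succ {ι : Type*} {m : ℕ} {C : ι → Set X} (h : HasCommonPoints m C)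
    (h' : ∀ s : Finset ι, s.card = m + 1 → (⋂ i ∈ s, C i).Nonempty) :
    HasCommonPoints (m + 1) C := fun s hs => by
  rcases hs.eq_or_lt with hs | hs
  · exact h' s hs
  · exact h s (Nat.lt_succ_iff.1 hs)

variable [MetricSpace X]

/-! ### Geodesic simplices and covering dimension -/

/-- The singular simplex with vertices `p 0, …, p k` obtained by iterated geodesic coning,
parametrized by the cube. -/
noncomputable def iteratedCone (hgeo : IsGeodesicSpace X) (p : ℕ → X) (x : ℕ → ℝ) : ℕ → X
  | 0 => p 0
  | k + 1 => geodesicPoint hgeo (iteratedCone hgeo p x k) (p (k + 1)) (x k)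

lemma continuous_iteratedCone (hgeo : IsGeodesicSpace X) (hcat : SatisfiesCAT0 X) (p : ℕ → X)
    {T : Type*} [TopologicalSpace T] {x : T → ℕ → ℝ} (hx : Continuous x) (k : ℕ) :
    Continuous fun a => iteratedCone hgeo p (x a) k := by
  induction k with
  | zero => exact continuous_const
  | succ k ih => exact ih.geodesicPoint hgeo hcat continuous_const ((continuous_apply k).comp hx)

/-- A zero parameter skips the vertex to be added at that stage, so this vertex need not lie in `A`.
-/
lemma iteratedCone_mem_of_eq_zero (hgeo : IsGeodesicSpace X) {A : Set X}
    (hA : IsGeodesicallyConvex A) {p : ℕ → X} {x : ℕ → ℝ} (h0 : p 0 ∈ A) (k : ℕ)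
    (h : ∀ i < k, p (i + 1) ∈ A ∨ x i = 0) : iteratedCone hgeo p x k ∈ A := by
  induction k with
  | zero => exact h0
  | succ k ih =>
    have hk := ih fun i hi => h i (hi.trans k.lt_succ_self)
    rcases h k k.lt_succ_self with h | h
    · exact hA.geodesicPoint_mem hgeo hk h _
    · rwa [iteratedCone, h, geodesicPoint_zero]

/-- A parameter equal to 1 jumps to the new vertex and forgets all earlier ones. -/
lemma iteratedCone_mem_of_eq_one (hgeo : IsGeodesicSpace X) {A : Set X}
    (hA : IsGeodesicallyConvex A) {p : ℕ → X} {x : ℕ → ℝ} {j k : ℕ} (hjk : j < k) (hx : x j = 1)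
    (h : ∀ i, j < i → i ≤ k → p i ∈ A) : iteratedCone hgeo p x k ∈ A := by
  induction k, (hjk : j + 1 ≤ k) using Nat.le_induction with
  | base =>
    rw [iteratedCone, hx, geodesicPoint_one]
    exact h _ j.lt_succ_self le_rfl
  | succ k hk ih =>
    exact hA.geodesicPoint_mem hgeo (ih fun i h1 h2 => h i h1 (h2.trans k.le_succ))
      (h _ (by omega) le_rfl) _

/-- The face of the cube that is parametrized onto the face of the simplex opposite to the vertex
`i`. -/
def cubeFace {d : ℕ} (i : Fin (d + 1)) : Set (Fin d → ℝ) :=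
  Set.Icc 0 1 ∩
    ((⋃ (j : Fin d) (_ : j.succ = i), {x | x j = 0}) ∪ ⋃ (j : Fin d) (_ : (i : ℕ) ≤ j), {x | x j = 1})

lemma isCompact_cubeFace {d : ℕ} (i : Fin (d + 1)) : IsCompact (cubeFace i) := by
  refine isCompact_Icc.inter_right (IsClosed.union ?_ ?_) <;>
  exact isClosed_iUnion_of_finite fun j => isClosed_iUnion_of_finite fun _ =>
    isClosed_eq (continuous_apply j) continuous_const

/-- A space of covering dimension at most `n` has no essential `(n + 1)`-simplex. -/
lemma CoveringDimLE.exists_mem_image_cubeFace {n : ℕ} (hdim : CoveringDimLE X n)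
    {F : (Fin (n + 1) → ℝ) → X} (hF : Continuous F) :
    ∃ y, ∀ i : Fin (n + 2), y ∈ F '' cubeFace i := by
  by_contra! hempty
  obtain ⟨𝒱, hVo, hVc, hVU, hVn⟩ := hdim (Set.range fun i : Fin (n + 2) => (F '' cubeFace i)ᶜ)
    (Set.finite_range _)
    (by
      rintro _ ⟨i, rfl⟩
      exact ((isCompact_cubeFace i).image hF).isClosed.isOpen_compl)
    (Set.eq_univ_of_forall fun y => (hempty y).elim fun i hi => ⟨_, ⟨i, rfl⟩, hi⟩)
  have hidx : ∀ V, ∃ i : Fin (n + 2), V ∈ 𝒱 → V ⊆ (F '' cubeFace i)ᶜ := by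
    intro V
    by_cases hV : V ∈ 𝒱
    · obtain ⟨_, ⟨i, rfl⟩, hi⟩ := hVU V hV
      exact ⟨i, fun _ => hi⟩
    · exact ⟨0, fun h => absurd h hV⟩
  choose idx hidx using hidx
  -- Members of the refinement are grouped by a face image that they avoid. A point in all groups
  -- lies in n + 2 distinct members, one for each index.
  obtain ⟨x, -, hx⟩ := exists_mem_iInter_of_cube_cover
    (fun i => F ⁻¹' ⋃₀ {V ∈ 𝒱 | idx V = i})
    (fun i => (isOpen_sUnion fun V hV => hVo V hV.1).preimage hF)
    (fun x _ => by
      obtain ⟨V, hV, hxV⟩ : F x ∈ ⋃₀ 𝒱 := hVc ▸ Set.mem_univ _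
      exact Set.mem_iUnion.2 ⟨idx V, V, ⟨hV, rfl⟩, hxV⟩)
    (by
      rintro x hx j hj ⟨V, ⟨hV, hi⟩, hxV⟩
      exact hidx V hV hxV ⟨x, ⟨hx, Or.inl (Set.mem_iUnion₂.2 ⟨j, hi.symm, hj⟩)⟩, rfl⟩)
    (by
      rintro x hx j hj i hij ⟨V, ⟨hV, rfl⟩, hxV⟩
      exact hidx V hV hxV ⟨x, ⟨hx, Or.inr (Set.mem_iUnion₂.2 ⟨j, hij, hj⟩)⟩, rfl⟩)
  choose v hv hxv using hx
  have hinj : Function.Injective v := fun i j hij => by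
    rw [← (hv i).2, ← (hv j).2, hij]
  have h1 : (Set.range v).encard ≤ n + 1 :=
    (Set.encard_le_encard (by
      rintro _ ⟨i, rfl⟩
      exact ⟨(hv i).1, hxv i⟩)).trans (hVn (F x))
  rw [← Set.image_univ, hinj.encard_image, Set.encard_univ, ENat.card_eq_coe_fintype_card,
    Fintype.card_fin] at h1
  have : n + 2 ≤ n + 1 := by exact_mod_cast h1
  omega

/-- Convex sets that contain the faces of a simplex of dimension `n + 1` have a common point. -/
lemma iInter_nonempty_of_simplex (hgeo : IsGeodesicSpace X) (hcat : SatisfiesCAT0 X) {n : ℕ}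
    (hdim : CoveringDimLE X n) {C : Fin (n + 2) → Set X} (hC : ∀ i, IsGeodesicallyConvex (C i))
    (p : Fin (n + 2) → X) (hp : ∀ i j, j ≠ i → p j ∈ C i) : ∃ y, ∀ i, y ∈ C i := by
  let q : ℕ → X := fun k => if h : k < n + 2 then p ⟨k, h⟩ else p 0
  have hq : ∀ (i : Fin (n + 2)) (k : ℕ), k < n + 2 → k ≠ i → q k ∈ C i := by
    intro i k hk hki
    simp only [q, dif_pos hk]
    exact hp _ _ fun h => hki (congrArg Fin.val h)
  let ext : (Fin (n + 1) → ℝ) → ℕ → ℝ := fun x k => if h : k < n + 1 then x ⟨k, h⟩ else 0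
  have hext : Continuous ext := by
    refine continuous_pi fun k => ?_
    by_cases h : k < n + 1
    · simpa only [ext, dif_pos h] using continuous_apply _
    · simpa only [ext, dif_neg h] using continuous_const
  have hext' : ∀ x (j : Fin (n + 1)), ext x j = x j := fun x j => dif_pos j.isLt
  obtain ⟨y, hy⟩ := hdim.exists_mem_image_cubeFace (continuous_iteratedCone hgeo hcat q hext (n + 1))
  refine ⟨y, fun i => ?_⟩
  obtain ⟨x, ⟨-, hx | hx⟩, rfl⟩ := hy i
  · obtain ⟨j, rfl, hj⟩ := Set.mem_iUnion₂.1 hx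
    refine iteratedCone_mem_of_eq_zero hgeo (hC _) (hq _ 0 (by omega) (by simp)) _ fun k hk => ?_
    rcases eq_or_ne k j with rfl | hkj
    · exact Or.inr ((hext' x j).trans hj)
    · exact Or.inl (hq _ _ (by omega) (by simpa using hkj))
  · obtain ⟨j, hij, hj⟩ := Set.mem_iUnion₂.1 hx
    exact iteratedCone_mem_of_eq_one hgeo (hC _) j.isLt ((hext' x j).trans hj)
      fun k h1 h2 => hq _ _ (by omega) (by omega)

/-- **Helly's theorem** for CAT(0) spaces of covering dimension at most `n`: the inductive step. -/
lemma HasCommonPoints.helly_succ (hgeo : IsGeodesicSpace X) (hcat : SatisfiesCAT0 X) {n : ℕ}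
    (hdim : CoveringDimLE X n) {ι : Type*} {C : ι → Set X} (hC : ∀ i, IsGeodesicallyConvex (C i))
    {m : ℕ} (hm : n + 1 ≤ m) (h : HasCommonPoints m C) : HasCommonPoints (m + 1) C := by
  classical
  refine h.succ fun s hs => ?_
  -- Only n + 2 members play the role of faces; the remaining ones are intersected into each of
  -- them.
  obtain ⟨t, hts, ht⟩ := Finset.exists_subset_card_eq (s := s) (n := n + 2) (by omega)
  let e : Fin (n + 2) ≃ t := (Finset.equivFinOfCardEq ht).symm
  have hcard : ∀ i : Fin (n + 2), (s.erase (e i)).card ≤ m := fun i => by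
    rw [Finset.card_erase_of_mem (hts (e i).2), hs, Nat.add_sub_cancel]
  choose p hp using fun i => h _ (hcard i)
  simp only [Set.mem_iInter, Finset.mem_erase] at hp
  obtain ⟨y, hy⟩ := iInter_nonempty_of_simplex hgeo hcat hdim
    (C := fun i => C (e i) ∩ ⋂ j ∈ (↑(s \ t) : Set ι), C j)
    (fun i => (hC _).inter (IsGeodesicallyConvex.biInter fun j _ => hC j)) p (by
      refine fun i j hji => ⟨hp j _ ⟨fun h => hji (e.injective (Subtype.ext h)).symm, hts (e i).2⟩,
        Set.mem_iInter₂.2 fun k hk => ?_⟩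
      rw [Finset.mem_coe, Finset.mem_sdiff] at hk
      exact hp j k ⟨fun h => hk.2 (h ▸ (e j).2), hk.1⟩)
  refine ⟨y, Set.mem_iInter₂.2 fun i hi => ?_⟩
  by_cases hit : i ∈ t
  · simpa using (hy (e.symm ⟨i, hit⟩)).1
  · exact Set.mem_iInter₂.1 (hy 0).2 i (by simp [hi, hit])

/-- **Helly's theorem** for CAT(0) spaces of covering dimension at most `n`. -/
theorem HasCommonPoints.helly (hgeo : IsGeodesicSpace X) (hcat : SatisfiesCAT0 X) {n : ℕ}
    (hdim : CoveringDimLE X n) {ι : Type*} {C : ι → Set X} (hC : ∀ i, IsGeodesicallyConvex (C i))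
    (h : HasCommonPoints (n + 1) C) (s : Finset ι) : (⋂ i ∈ s, C i).Nonempty := by
  have : ∀ m, n + 1 ≤ m → HasCommonPoints m C := fun m hm => by
    induction m, hm using Nat.le_induction with
    | base => exact h
    | succ m hm ih => exact ih.helly_succ hgeo hcat hdim hC hm
  exact this (max (n + 1) s.card) (le_max_left _ _) s (le_max_right _ _)

end Helly

/-! ### Thickened Helly property of hyperbolic spaces -/

section Hyperbolic

variable {X : Type*} [MetricSpace X] {δ : ℝ}

lemma IsGeodesicSegment.isCompact {x y : X} {S : Set X} (hS : IsGeodesicSegment x y S) :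
    IsCompact S := by
  obtain ⟨γ, hγ, rfl⟩ := hS
  exact isCompact_Icc.image_of_continuousOn hγ.continuousOn

lemma IsGeodesicSegment.isPreconnected {x y : X} {S : Set X} (hS : IsGeodesicSegment x y S) :
    IsPreconnected S := by
  obtain ⟨γ, hγ, rfl⟩ := hS
  exact isPreconnected_Icc.image _ hγ.continuousOn

lemma IsGeodesicSegment.left_mem {x y : X} {S : Set X} (hS : IsGeodesicSegment x y S) : x ∈ S := by
  obtain ⟨γ, hγ, rfl⟩ := hS
  exact ⟨0, ⟨le_rfl, dist_nonneg⟩, hγ.source⟩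

lemma IsGeodesicSegment.right_mem {x y : X} {S : Set X} (hS : IsGeodesicSegment x y S) :
    y ∈ S := by
  obtain ⟨γ, hγ, rfl⟩ := hS
  exact ⟨_, ⟨dist_nonneg, le_rfl⟩, hγ.target⟩

lemma IsCompact.isClosed_thickening {K : Set X} (hK : IsCompact K) (hne : K.Nonempty) (r : ℝ) :
    IsClosed (thickening r K) := by
  have : thickening r K = {x | Metric.infDist x K ≤ r} := by
    ext x
    refine ⟨fun ⟨b, hb, h⟩ => (Metric.infDist_le_dist_of_mem hb).trans h, fun h => ?_⟩
    obtain ⟨b, hb, h'⟩ := hK.exists_infDist_eq_dist hne x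
    exact ⟨b, hb, h' ▸ h⟩
  rw [this]
  exact isClosed_le (Metric.continuous_infDist_pt K) continuous_const

lemma subset_thickening {r : ℝ} (hr : 0 ≤ r) (B : Set X) : B ⊆ thickening r B :=
  fun x hx => ⟨x, hx, by rwa [dist_self]⟩

lemma thickening_mono (r : ℝ) {A B : Set X} (h : A ⊆ B) : thickening r A ⊆ thickening r B :=
  fun _ ⟨b, hb, hr⟩ => ⟨b, h hb, hr⟩

lemma thickening_thickening_subset (r s : ℝ) (B : Set X) :
    thickening r (thickening s B) ⊆ thickening (s + r) B := by
  rintro x ⟨y, ⟨b, hb, hy⟩, hx⟩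
  exact ⟨b, hb, by linarith [dist_triangle x y b]⟩

lemma IsDeltaHyperbolic.nonneg (hgeo : IsGeodesicSpace X) [Nonempty X]
    (hδ : IsDeltaHyperbolic X δ) : 0 ≤ δ := by
  obtain ⟨x⟩ := ‹Nonempty X›
  obtain ⟨S, hS⟩ := hgeo x x
  obtain ⟨q, -, hq⟩ := hδ x x x S S S hS hS hS x hS.left_mem
  exact dist_nonneg.trans hq

/-- Three pairwise intersecting convex sets have a point in common up to `δ`. -/
lemma IsDeltaHyperbolic.exists_mem_thickening (hgeo : IsGeodesicSpace X)
    (hδ : IsDeltaHyperbolic X δ) (hδ0 : 0 ≤ δ) {A B C : Set X} (hA : IsGeodesicallyConvex A)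
    (hB : IsGeodesicallyConvex B) (hC : IsGeodesicallyConvex C) (hAB : (A ∩ B).Nonempty)
    (hBC : (B ∩ C).Nonempty) (hCA : (C ∩ A).Nonempty) :
    ∃ x, x ∈ thickening δ A ∧ x ∈ thickening δ B ∧ x ∈ thickening δ C := by
  obtain ⟨x, hxA, hxB⟩ := hAB
  obtain ⟨z, hzB, hzC⟩ := hBC
  obtain ⟨y, hyC, hyA⟩ := hCA
  obtain ⟨S, hS⟩ := hgeo x y
  obtain ⟨T, hT⟩ := hgeo y z
  obtain ⟨U, hU⟩ := hgeo z x
  -- The side `S` is connected and covered by the closed δ-neighbourhoods of the other two sides,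
  -- each of which contains an endpoint of `S`; hence some point of `S` is in both.
  obtain ⟨p, hpS, hpT, hpU⟩ := isPreconnected_closed_iff.1 hS.isPreconnected
    (thickening δ T) (thickening δ U) (hT.isCompact.isClosed_thickening ⟨_, hT.left_mem⟩ δ)
    (hU.isCompact.isClosed_thickening ⟨_, hU.left_mem⟩ δ)
    (fun p hp => by
      obtain ⟨q, hq | hq, h⟩ := hδ x y z S T U hS hT hU p hp
      · exact Or.inl ⟨q, hq, h⟩
      · exact Or.inr ⟨q, hq, h⟩)
    ⟨y, hS.right_mem, subset_thickening hδ0 _ hT.left_mem⟩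
    ⟨x, hS.left_mem, subset_thickening hδ0 _ hU.right_mem⟩
  exact ⟨p, subset_thickening hδ0 _ (hA x hxA y hyA S hS hpS),
    thickening_mono δ (hB z hzB x hxB U hU) hpU, thickening_mono δ (hC y hyC z hzC T hT) hpT⟩

lemma IsDeltaHyperbolic.hasCommonPoints_succ (hgeo : IsGeodesicSpace X)
    (hδ : IsDeltaHyperbolic X δ) (hδ0 : 0 ≤ δ) {ι : Type*} {B : ι → Set X}
    (hB : ∀ i, IsGeodesicallyConvex (B i)) {m : ℕ} (hm : 2 ≤ m) (h : HasCommonPoints m B) :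
    HasCommonPoints (m + 1) fun i => thickening δ (B i) := by
  classical
  refine (h.mono fun i => subset_thickening hδ0 _).succ fun s hs => ?_
  obtain ⟨t, hts, ht⟩ := Finset.exists_subset_card_eq (s := s) (n := 3) (by omega)
  obtain ⟨a, b, c, hab, hac, hbc, rfl⟩ := Finset.card_eq_three.1 ht
  simp only [Finset.insert_subset_iff, Finset.singleton_subset_iff] at hts
  set D : Set X := ⋂ j ∈ (↑(s \ {a, b, c}) : Set ι), B j with hD
  have hconv : ∀ i, IsGeodesicallyConvex (B i ∩ D) := fun i =>
    (hB i).inter (IsGeodesicallyConvex.biInter fun j _ => hB j)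
  -- Two of the three sets together with `D` involve only the members other than the third, at most
  -- m in number.
  have hne : ∀ i ∈ s, ∀ j ∈ s, ∀ k ∈ s, i ≠ k → j ≠ k → k ∈ ({a, b, c} : Finset ι) →
      ((B i ∩ D) ∩ (B j ∩ D)).Nonempty := by
    intro i hi j hj k hk hik hjk hkt
    obtain ⟨x, hx⟩ := h (s.erase k) (by
      rw [Finset.card_erase_of_mem hk, hs, Nat.add_sub_cancel])
    simp only [Set.mem_iInter, Finset.mem_erase] at hx
    have hxD : x ∈ D := Set.mem_iInter₂.2 fun l hl => by
      rw [Finset.mem_coe, Finset.mem_sdiff] at hl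
      exact hx l ⟨fun h => hl.2 (h ▸ hkt), hl.1⟩
    exact ⟨x, ⟨hx i ⟨hik, hi⟩, hxD⟩, hx j ⟨hjk, hj⟩, hxD⟩
  obtain ⟨x, hxa, hxb, hxc⟩ := hδ.exists_mem_thickening hgeo hδ0 (hconv a) (hconv b) (hconv c)
    (hne a hts.1 b hts.2.1 c hts.2.2 hac hbc (by simp))
    (hne b hts.2.1 c hts.2.2 a hts.1 hab.symm hac.symm (by simp))
    (hne c hts.2.2 a hts.1 b hts.2.1 hbc.symm hab (by simp))
  refine ⟨x, Set.mem_iInter₂.2 fun i hi => ?_⟩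
  by_cases hit : i ∈ ({a, b, c} : Finset ι)
  · simp only [Finset.mem_insert, Finset.mem_singleton] at hit
    rcases hit with rfl | rfl | rfl
    · exact thickening_mono δ Set.inter_subset_left hxa
    · exact thickening_mono δ Set.inter_subset_left hxb
    · exact thickening_mono δ Set.inter_subset_left hxc
  · refine thickening_mono δ (fun y hy => ?_) hxa
    exact Set.mem_iInter₂.1 hy.2 i (by rw [Finset.mem_coe, Finset.mem_sdiff]; exact ⟨hi, hit⟩)

lemma IsDeltaHyperbolic.hasCommonPoints_thickening (hgeo : IsGeodesicSpace X)
    (hcat : SatisfiesCAT0 X) (hδ : IsDeltaHyperbolic X δ) (hδ0 : 0 ≤ δ) {ι : Type*} {B : ι → Set X}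
    (hB : ∀ i, IsGeodesicallyConvex (B i)) (h : HasCommonPoints 2 B) (m : ℕ) :
    HasCommonPoints (m + 2) fun i => thickening (m * δ) (B i) := by
  induction m with
  | zero => exact h.mono fun i => subset_thickening (by simp) _
  | succ m ih =>
    refine (hδ.hasCommonPoints_succ hgeo hδ0 (fun i => (hB i).thickening hgeo hcat _)
      (by omega) ih).mono fun i => (thickening_thickening_subset _ _ _).trans_eq ?_
    push_cast
    rw [add_one_mul]

end Hyperbolic

/-! ### Conclusion -/

theorem mainTheorem9 {X : Type*} [MetricSpace X] (n : ℕ) (δ : ℝ)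
    (hX : IsHadamardSpace X) (hdim : IsNDimensional X n) (hδ : IsDeltaHyperbolic X δ)
    (k : ℕ) (B : Fin k → Set X) (hconv : ∀ i, IsGeodesicallyConvex (B i))
    (hB : ∀ i j, (B i ∩ B j).Nonempty) :
    ∃ x : X, ∀ i, Metric.infDist x (B i) ≤ n * δ := by
  have := hX.nonempty
  have hδ0 := hδ.nonneg hX.geodesic
  have h2 : HasCommonPoints 2 B := by
    classical
    intro s hs
    rcases s.eq_empty_or_nonempty with rfl | ⟨i, hi⟩
    · simp
    · have h1 : (s.erase i).card ≤ 1 := by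
        rw [Finset.card_erase_of_mem hi]
        omega
      obtain ⟨j, hj⟩ : ∃ j, s.erase i ⊆ {j} := by
        have : Nonempty (Fin k) := ⟨i⟩
        exact Finset.card_le_one_iff_subset_singleton.1 h1
      refine (hB i j).mono fun x hx => Set.mem_iInter₂.2 fun l hl => ?_
      rcases eq_or_ne l i with rfl | hli
      · exact hx.1
      · rw [Finset.mem_singleton.1 (hj (Finset.mem_erase.2 ⟨hli, hl⟩))]
        exact hx.2
  have hn := hδ.hasCommonPoints_thickening hX.geodesic hX.cat0 hδ0 hconv h2 n
  obtain ⟨x, hx⟩ := HasCommonPoints.helly hX.geodesic hX.cat0 hdim.1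
    (fun i => (hconv i).thickening hX.geodesic hX.cat0 (n * δ))
    -- Helly needs only n + 1 sets at a time, while n rounds of thickening provide n + 2.
    (fun s hs => hn s (by omega)) Finset.univ
  refine ⟨x, fun i => ?_⟩
  obtain ⟨b, hb, hxb⟩ := Set.mem_iInter₂.1 hx i (Finset.mem_univ i)
  exact (Metric.infDist_le_dist_of_mem hb).trans hxb
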